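/- Let $K$ be a number field with ring of integers $O_K$, let $\bar K$ be a separable closure of $K$ and $O_{\bar K}$ its ring of algebraic integers. Let $I_K$ be the monoid of nonzero ideals of $O_K$ and $P_K\subseteq I_K$ the set of nonzero primes; for $\mathfrak p\in P_K$ let $k_{\mathfrak p}=O_K/\mathfrak p$. On $O_{\bar K}^{I_K}$ let $\psi_{\mathfrak a}$ ($\mathfrak a\in I_K$) be the shift $(\psi_{\mathfrak a}\xi)_{\mathfrak b}=\xi_{\mathfrak a\mathfrak b}$. Put $U_0=O_{\bar K}^{I_K}$, $U_{n+1}=\{\xi\in U_n:\ \psi_{\mathfrak p}\xi-\xi^{\#k_{\mathfrak p}}\in\mathfrak p U_n\text{ for all }\mathfrak p\in P_K\}$, and let $W(O_{\bar K})=\bigcap_{n\ge 0} U_n$ be the ring of Witt vectors over $O_K$ with coefficients in $O_{\bar K}$. A Witt vector $\xi$ is automatic if there are a finite set $S$, a map $\delta:S\times P_K\to S$, an initial state $s_0\in S$ and an output map $\tau:S\to O_{\bar K}$ such that, for every finite word $\mathfrak p_1\mathfrak p_2\cdots\mathfrak p_r$ over $P_K$, the coefficient $\xi_{\mathfrak p_1\cdots\mathfrak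 p_r}$ is the output $\tau(s)$ at the state $s$ reached from $s_0$ by reading the word through $\delta$. Let $W^a(O_{\bar K})\subseteq W(O_{\bar K})$ be the subring of automatic Witt vectors. A $\Lambda$-ring (over $O_K$) is a flat $O_K$-algebra $A$ with commuting $O_K$-algebra endomorphisms $\psi_{\mathfrak p}$ ($\mathfrak p\in P_K$) such that $\psi_{\mathfrak p}a-a^{\#k_{\mathfrak p}}\in\mathfrak pA$ for all $a\in A$. If $X$ is a $K$-algebra that is a $\Lambda$-ring and is finite over $K$, an integral $\Lambda$-model of $X$ is an $O_K$-subalgebra $B\subseteq X$ that is stable under all $\psi_{\mathfrak p}$, is a $\Lambda$-ring for the restrictions of the $\psi_{\mathfrak p}$, is finite over $O_K$, and for which the canonical map $K\otimes_{O_K}B\to X$ is an isomorphism. **Proposition.** Let $\xi\in W(O_{\bar K})$ be integral over $O_K$, and let $O_K\langle\xi\rangle$ be the $O_K$-algebra generated by the orbit $\{\psi_{\mathfrak a}\xi:\mathfrak a\in I_K\}$. Then $X=K\otimes_{O_K}O_K\langle\xi\rangle$, with the operators $\mathrm{id}\otimes\psi_{\mathfrak p}$, is a $\Lambda$-ring that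 is finite étale over $K$ and has an integral $\Lambda$-model. Moreover $W^a(O_{\bar K})\cap X$ (intersection inside $\bar K^{I_K}$) is an integral $\Lambda$-model of $X$, and it contains every integral $\Lambda$-model of $X$. -/

import Mathlib

open scoped TensorProduct NumberField
open IsDedekindDomain

noncomputable section

namespace LambdaWitt

section General

set_option linter.unusedSectionVars false

variable (R : Type*) [CommRing R] [IsDedekindDomain R]

/-- The monoid `I_K` of nonzero ideals of the Dedekind domain `R` (with fraction field `K`). The set
`P_K` of nonzero prime ideals is `HeightOneSpectrum R`. -/
abbrev NonzeroIdeal : Type _ := nonZeroDivisors (Ideal R)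

variable {R}

/-- A nonzero prime ideal, regarded as an element of the monoid of nonzero ideals. -/
def primeIdeal (p : HeightOneSpectrum R) : NonzeroIdeal R :=
  ⟨p.asIdeal, mem_nonZeroDivisors_of_ne_zero p.ne_bot⟩

/-- The cardinality `#k_p` of the residue field `R / p`. -/
def residueCard (p : HeightOneSpectrum R) : ℕ := Nat.card (R ⧸ p.asIdeal)

variable (R) in
/-- A `Λ_R`-ring structure on an `R`-algebra `A` with given endomorphisms `ψ_p`: `A` is flat over
`R`, the `R`-algebra endomorphisms `ψ_p` commute with each other, and
`ψ_p a ≡ a ^ #k_p` modulo `p A`. -/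
structure IsLambdaRing (A : Type*) [CommRing A] [Algebra R A]
    (ψ : HeightOneSpectrum R → A →ₐ[R] A) : Prop where
  flat : Module.Flat R A
  comm : ∀ p q, (ψ p).comp (ψ q) = (ψ q).comp (ψ p)
  frobenius : ∀ p a, ψ p a - a ^ residueCard p ∈ p.asIdeal.map (algebraMap R A)

/-- `B` is a sub-`Λ_R`-ring of `(X, ψ)`: it is stable under all `ψ_p`, and is a `Λ_R`-ring for their
restrictions. -/
def IsSubLambdaRing {X : Type*} [CommRing X] [Algebra R X]
    (ψ : HeightOneSpectrum R → X →ₐ[R] X) (B : Subalgebra R X) : Prop :=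
  ∃ h : ∀ (p : HeightOneSpectrum R) (b : B), ψ p b ∈ B,
    IsLambdaRing R B (fun p => ((ψ p).comp B.val).codRestrict B (h p))

/-- `B` is an integral (`Λ`-)model of the `K`-algebra `X` with operators `ψ_p`: it is a
sub-`Λ_R`-ring of `X` which is finite over `R`, and the canonical map `K ⊗_R B → X`,
`c ⊗ b ↦ c b`, is an isomorphism. -/
structure IsIntegralModel (K : Type*) [Field K] [Algebra R K] {X : Type*} [CommRing X] [Algebra R X]
    [Algebra K X] [IsScalarTower R K X]
    (ψ : HeightOneSpectrum R → X →ₐ[R] X) (B : Subalgebra R X) : Prop where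
  isSubLambdaRing : IsSubLambdaRing ψ B
  finite : Module.Finite R B
  bijective : Function.Bijective
    (Algebra.TensorProduct.productMap (IsScalarTower.toAlgHom R K X) B.val)

section Witt

variable (R) (A : Type*) [CommRing A] [Algebra R A]

variable {R} in
/-- The shift `ψ_a : A^{I_K} → A^{I_K}`, `(ψ_a ξ)_b = ξ_{ab}`. -/
def shift (a : NonzeroIdeal R) : (NonzeroIdeal R → A) →ₐ[R] (NonzeroIdeal R → A) where
  toFun ξ b := ξ (a * b)
  map_one' := rfl
  map_mul' _ _ := rfl
  map_zero' := rfl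
  map_add' _ _ := rfl
  commutes' _ := rfl

/-- `ψ_{ab} = ψ_a ∘ ψ_b`, so that `ψ_a` is the composite of the `ψ_p` for the prime factors `p`
of `a`. -/
theorem shift_mul (a b : NonzeroIdeal R) : shift A (a * b) = (shift A a).comp (shift A b) := by
  ext ξ c
  change ξ (a * b * c) = ξ (b * (a * c))
  rw [mul_comm a b, mul_assoc]

variable {R A}

theorem mul_mem_smul {B : Type*} [CommRing B] [Algebra R B] (I : Ideal R) (U : Subalgebra R B)
    {x y : B} (hx : x ∈ U) (hy : y ∈ I • Subalgebra.toSubmodule U) :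
    x * y ∈ I • Subalgebra.toSubmodule U := by
  refine Submodule.smul_induction_on hy (fun r hr n hn => ?_) (fun a b ha hb => ?_)
  · rw [mul_smul_comm]
    exact Submodule.smul_mem_smul hr (U.mul_mem hx hn)
  · rw [mul_add]
    exact add_mem ha hb

theorem residueCard_eq [Ring.HasFiniteQuotients R] (p : HeightOneSpectrum R) :
    ∃ (l n : ℕ), l.Prime ∧ residueCard p = l ^ n ∧ 0 < n ∧ (l : R) ∈ p.asIdeal := by
  have : Finite (R ⧸ p.asIdeal) := Ring.HasFiniteQuotients.finiteQuotient p.ne_bot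
  have := Fintype.ofFinite (R ⧸ p.asIdeal)
  have := p.isMaximal
  let _ : Field (R ⧸ p.asIdeal) := Ideal.Quotient.field _
  obtain ⟨l, hl⟩ := CharP.exists (R ⧸ p.asIdeal)
  obtain ⟨n, hlp, hn⟩ := FiniteField.card (R ⧸ p.asIdeal) l
  refine ⟨l, n, hlp, ?_, n.pos, ?_⟩
  · rw [residueCard, Nat.card_eq_fintype_card, hn]
  · rw [← Ideal.Quotient.eq_zero_iff_mem, map_natCast]
    exact CharP.cast_eq_zero _ _

theorem sub_pow_mem [Ring.HasFiniteQuotients R] (p : HeightOneSpectrum R) (r : R) :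
    r - r ^ residueCard p ∈ p.asIdeal := by
  have : Finite (R ⧸ p.asIdeal) := Ring.HasFiniteQuotients.finiteQuotient p.ne_bot
  have := Fintype.ofFinite (R ⧸ p.asIdeal)
  have := p.isMaximal
  let _ : Field (R ⧸ p.asIdeal) := Ideal.Quotient.field _
  rw [← Ideal.Quotient.eq_zero_iff_mem, map_sub, map_pow, residueCard, Nat.card_eq_fintype_card,
    FiniteField.pow_card, sub_self]

variable [Ring.HasFiniteQuotients R]

/-- The step `U_n(A) ↦ U_{n+1}(A)`: the elements `ξ ∈ U` with
`ψ_p ξ - ξ ^ #k_p ∈ p U` for all nonzero primes `p`. -/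
def nextU (U : Subalgebra R (NonzeroIdeal R → A)) : Subalgebra R (NonzeroIdeal R → A) where
  carrier := {ξ | ξ ∈ U ∧ ∀ p : HeightOneSpectrum R,
    shift A (primeIdeal p) ξ - ξ ^ residueCard p ∈ p.asIdeal • Subalgebra.toSubmodule U}
  mul_mem' := by
    rintro x y ⟨hx, hx'⟩ ⟨hy, hy'⟩
    refine ⟨U.mul_mem hx hy, fun p => ?_⟩
    have hle : p.asIdeal • Subalgebra.toSubmodule U ≤ Subalgebra.toSubmodule U :=
      Submodule.smul_le_right
    have hψ : shift A (primeIdeal p) y ∈ U := by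
      have := U.add_mem (hle (hy' p)) (U.pow_mem hy (residueCard p))
      simpa using this
    have h1 := mul_mem_smul p.asIdeal U hψ (hx' p)
    have h2 := mul_mem_smul p.asIdeal U (U.pow_mem hx (residueCard p)) (hy' p)
    convert add_mem h1 h2 using 1
    rw [map_mul]
    ring
  add_mem' := by
    rintro x y ⟨hx, hx'⟩ ⟨hy, hy'⟩
    refine ⟨U.add_mem hx hy, fun p => ?_⟩
    obtain ⟨l, n, hl, hq, -, hmem⟩ := residueCard_eq p
    obtain ⟨r, hr⟩ := exists_add_pow_prime_pow_eq hl (⟨x, hx⟩ : U) ⟨y, hy⟩ n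
    have hr' := congrArg (Subtype.val : U → _) hr
    simp only [Subalgebra.coe_pow, Subalgebra.coe_add, Subalgebra.coe_mul] at hr'
    rw [← hq] at hr'
    have h3 : (l : R) • ((⟨x, hx⟩ * ⟨y, hy⟩ * r : U) : NonzeroIdeal R → A)
        ∈ p.asIdeal • Subalgebra.toSubmodule U :=
      Submodule.smul_mem_smul hmem (SetLike.coe_mem _)
    rw [Nat.cast_smul_eq_nsmul, nsmul_eq_mul] at h3
    rw [hr', map_add]
    convert sub_mem (add_mem (hx' p) (hy' p)) h3 using 1
    have hcast : ((l : U) : NonzeroIdeal R → A) = l := map_natCast U.val l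
    simp only [Subalgebra.coe_mul, hcast]
    ring
  algebraMap_mem' := by
    intro r
    refine ⟨U.algebraMap_mem r, fun p => ?_⟩
    rw [AlgHom.commutes, ← map_pow, ← map_sub, Algebra.algebraMap_eq_smul_one]
    exact Submodule.smul_mem_smul (sub_pow_mem p r) U.one_mem

variable (R A)

/-- The decreasing sequence of subalgebras `U_n(A) ⊆ A^{I_K}`. -/
def U : ℕ → Subalgebra R (NonzeroIdeal R → A)
  | 0 => ⊤
  | n + 1 => nextU (U n)

/-- The ring `W_R(A) = ⋂_n U_n(A)` of Witt vectors with coefficients in the (flat)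
`R`-algebra `A`. -/
def W : Subalgebra R (NonzeroIdeal R → A) := ⨅ n, U R A n

end Witt

/-- A deterministic finite automaton with output, with input alphabet `Δ` (possibly infinite) and
output alphabet `O`. -/
structure DFAO (Δ O : Type*) where
  State : Type
  finite : Finite State
  step : State → Δ → State
  start : State
  output : State → O

/-- The output of an automaton on a finite word, read from left to right. -/
def DFAO.eval {Δ O : Type*} (M : DFAO Δ O) (u : List Δ) : O :=
  M.output (u.foldl M.step M.start)

/-- A family `(ξ_a)` is automatic if some automaton with input alphabet `P_K` outputs
`ξ_{p_1 ⋯ p_r}` on every finite word `p_1 ⋯ p_r`. -/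
def IsAutomatic {A : Type*} (ξ : NonzeroIdeal R → A) : Prop :=
  ∃ M : DFAO (HeightOneSpectrum R) A, ∀ u : List (HeightOneSpectrum R),
    ξ (u.map primeIdeal).prod = M.eval u

theorem IsAutomatic.map₂ {A : Type*} {ξ η : NonzeroIdeal R → A} (hξ : IsAutomatic ξ)
    (hη : IsAutomatic η) (f : A → A → A) : IsAutomatic (fun a => f (ξ a) (η a)) := by
  obtain ⟨M, hM⟩ := hξ
  obtain ⟨N, hN⟩ := hη
  have := M.finite
  have := N.finite
  refine ⟨⟨M.State × N.State, inferInstance, fun s d => (M.step s.1 d, N.step s.2 d),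
    (M.start, N.start), fun s => f (M.output s.1) (N.output s.2)⟩, fun u => ?_⟩
  have key : ∀ (u : List (HeightOneSpectrum R)) (s : M.State × N.State),
      u.foldl (fun s d => (M.step s.1 d, N.step s.2 d)) s
        = (u.foldl M.step s.1, u.foldl N.step s.2) := by
    intro u
    induction u with
    | nil => intro s; rfl
    | cons d u ih => intro s; simp [ih]
  simp only [hM, hN, DFAO.eval, key]

theorem isAutomatic_const {A : Type*} (c : A) : IsAutomatic (fun _ : NonzeroIdeal R => c) :=
  ⟨⟨Unit, inferInstance, fun s _ => s, (), fun _ => c⟩, fun _ => rfl⟩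

variable [Ring.HasFiniteQuotients R]

variable (R) in
/-- The ring `W^a_R(A) ⊆ W_R(A)` of automatic Witt vectors. -/
def Wa (A : Type*) [CommRing A] [Algebra R A] : Subalgebra R (NonzeroIdeal R → A) where
  carrier := {ξ | ξ ∈ W R A ∧ IsAutomatic ξ}
  mul_mem' hx hy := ⟨(W R A).mul_mem hx.1 hy.1, hx.2.map₂ hy.2 (· * ·)⟩
  add_mem' hx hy := ⟨(W R A).add_mem hx.1 hy.1, hx.2.map₂ hy.2 (· + ·)⟩
  algebraMap_mem' r := ⟨(W R A).algebraMap_mem r, isAutomatic_const (algebraMap R A r)⟩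

section Orbit

variable {A : Type*} [CommRing A] [Algebra R A]

/-- The `R`-algebra `R⟨ξ⟩` generated by the orbit `I_K ξ = {ψ_a ξ | a ∈ I_K}`. -/
def orbitAlgebra (ξ : W R A) : Subalgebra R (NonzeroIdeal R → A) :=
  Algebra.adjoin R (Set.range fun a : NonzeroIdeal R => shift A a (ξ : NonzeroIdeal R → A))

theorem shift_mem_orbitAlgebra (ξ : W R A) (a : NonzeroIdeal R) (η : orbitAlgebra ξ) :
    shift A a (η : NonzeroIdeal R → A) ∈ orbitAlgebra ξ := by
  have h : orbitAlgebra ξ ≤ (orbitAlgebra ξ).comap (shift A a) := by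
    refine Algebra.adjoin_le ?_
    rintro _ ⟨b, rfl⟩
    refine Algebra.subset_adjoin ⟨a * b, ?_⟩
    simp only [shift_mul, AlgHom.comp_apply, RingHom.coe_coe]
  exact h η.2

/-- The operator `ψ_p` on `R⟨ξ⟩`. -/
def orbitPsi (ξ : W R A) (p : HeightOneSpectrum R) : orbitAlgebra ξ →ₐ[R] orbitAlgebra ξ :=
  ((shift A (primeIdeal p)).comp (orbitAlgebra ξ).val).codRestrict (orbitAlgebra ξ)
    (shift_mem_orbitAlgebra ξ (primeIdeal p))

/-- The operator `ψ_p` on `K ⊗_R R⟨ξ⟩`, given by `c ⊗ η ↦ c ⊗ ψ_p η`. -/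
def tensorPsi (K : Type*) [Field K] [Algebra R K] (ξ : W R A) (p : HeightOneSpectrum R) :
    K ⊗[R] orbitAlgebra ξ →ₐ[R] K ⊗[R] orbitAlgebra ξ :=
  Algebra.TensorProduct.map (AlgHom.id R K) (orbitPsi ξ p)

/-- The canonical map `K ⊗_R R⟨ξ⟩ → L^{I_K}`, `c ⊗ η ↦ (c η_a)_a`, where `A ⊆ L ⊇ K`. -/
def toProduct (K L : Type*) [Field K] [Algebra R K] [Field L] [Algebra K L] [Algebra R L]
    [IsScalarTower R K L] [Algebra A L] [IsScalarTower R A L] (ξ : W R A) :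
    K ⊗[R] orbitAlgebra ξ →ₐ[R] (NonzeroIdeal R → L) :=
  Algebra.TensorProduct.productMap (IsScalarTower.toAlgHom R K (NonzeroIdeal R → L))
    (((IsScalarTower.toAlgHom R A L).compLeft (NonzeroIdeal R)).comp (orbitAlgebra ξ).val)

/-- The intersection `W^a_R(A) ∩ (K ⊗_R R⟨ξ⟩)`, taken inside `L^{I_K}`, as a subalgebra
of `K ⊗_R R⟨ξ⟩`. -/
def maximalModel (K L : Type*) [Field K] [Algebra R K] [Field L] [Algebra K L] [Algebra R L]
    [IsScalarTower R K L] [Algebra A L] [IsScalarTower R A L] (ξ : W R A) :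
    Subalgebra R (K ⊗[R] orbitAlgebra ξ) :=
  ((Wa R A).map ((IsScalarTower.toAlgHom R A L).compLeft (NonzeroIdeal R))).comap
    (toProduct K L ξ)

end Orbit

end General

end LambdaWitt

end

/-! The central fact is that a Witt vector is automatic exactly when it has finitely many distinct
coefficients (`Wa_eq_finiteW`). One direction is clear, since an automaton has finitely many
outputs. For the other it suffices that the orbit under all shifts is finite (`finite_orbit`),
because the orbit then serves as the set of states.

Let `η` have finitely many values. Only finitely many primes divide a nonzero difference of two
values. For any other `p`, the congruence `η_{pa} ≡ η_a ^ #k_p` mod `p` makes `η_{pa}` a function of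
`η_a`, so products of such primes act through self-maps of a finite set. For a remaining prime `p`,
the recursion `ψ_p η = η ^ #k_p + θ` with `θ ∈ p W` shows by induction on `k` that `ψ_p^n η` is
eventually periodic modulo `p ^ k`. For large `k` the values are distinct modulo `p ^ k`, so the
periodicity is exact.

If `ξ` is integral, its coefficients are roots of one monic polynomial, so they are finite in number
and the orbit is finite. Hence `R⟨ξ⟩` is finite over `R`, and `X` is finite and reduced over the
perfect field `K`, thus étale. Elements of the maximal model are integral, which bounds it inside a
finite module. Conversely, elements of any integral model are integral, so they have finitely many
coefficients, all in `A`; the Frobenius congruences of the model place them in every `U_n`. -/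

noncomputable section

namespace LambdaWitt

/-! ### Ideal multiples of submodules over a Dedekind domain. -/

section Module

variable {R M : Type*} [CommRing R] [IsDedekindDomain R] [AddCommGroup M] [Module R M]
  [Module.IsTorsionFree R M]

/-- Membership in `p • N` can be tested after dividing by `p`: `p⁻¹ y ⊆ N`. -/
theorem mem_ideal_smul_iff {p : Ideal R} (hp : p ≠ ⊥) {N : Submodule R M} {y : M} :
    y ∈ p • N ↔ ∀ b c : R, c ≠ 0 → (∀ a ∈ p, c ∣ b * a) → ∃ z ∈ N, c • z = b • y := by
  constructor
  · intro hy b c _ hbc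
    refine Submodule.smul_induction_on hy (fun a ha n hn => ?_) ?_
    · obtain ⟨r, hr⟩ := hbc a ha
      exact ⟨r • n, N.smul_mem r hn, by rw [smul_smul, smul_smul, hr]⟩
    · rintro x y ⟨z, hz, hzx⟩ ⟨w, hw, hwy⟩
      exact ⟨z + w, N.add_mem hz hw, by rw [smul_add, smul_add, hzx, hwy]⟩
  · intro h
    obtain ⟨c, hc, hc0⟩ := Submodule.exists_mem_ne_zero_of_ne_bot hp
    -- With `(c) = p q`, every `b ∈ q` satisfies `b p ⊆ (c)`, so `h` applies to it. As `c` itself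
    -- lies in `p q`, cancelling it at the end leaves `y ∈ p • N`.
    obtain ⟨q, hq⟩ := Ideal.dvd_span_singleton.mpr hc
    have key : ∀ d ∈ p * q, ∃ w ∈ p • N, c • w = d • y := by
      intro d hd
      refine Submodule.mul_induction_on hd (fun a ha b hb => ?_) ?_
      · obtain ⟨z, hz, hzy⟩ := h b c hc0 fun a' ha' => by
          rw [← Ideal.mem_span_singleton, hq, mul_comm b]
          exact Ideal.mul_mem_mul ha' hb
        exact ⟨a • z, Submodule.smul_mem_smul ha hz, by rw [smul_comm, hzy, smul_smul]⟩
      · rintro d e ⟨z, hz, hzd⟩ ⟨w, hw, hwe⟩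
        exact ⟨z + w, add_mem hz hw, by rw [smul_add, add_smul, hzd, hwe]⟩
    obtain ⟨w, hw, hwy⟩ := key c (hq ▸ Ideal.mem_span_singleton_self c)
    rwa [← smul_right_injective M hc0 hwy]

/-- By torsion-freeness the quotient `z` of `b y` by `c` is unique, so the quotients found in the
various `N i` coincide. This passes from the `U_n` to their intersection. -/
theorem mem_ideal_smul_iInf {ι : Sort*} [Nonempty ι] {p : Ideal R} (hp : p ≠ ⊥)
    {N : ι → Submodule R M} {y : M} (h : ∀ i, y ∈ p • N i) : y ∈ p • ⨅ i, N i := by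
  rw [mem_ideal_smul_iff hp]
  intro b c hc hbc
  have h' i := (mem_ideal_smul_iff hp).mp (h i) b c hc hbc
  choose z hz hzy using h'
  obtain ⟨i⟩ := ‹Nonempty ι›
  refine ⟨z i, Submodule.mem_iInf _ |>.mpr fun j => ?_, hzy i⟩
  rw [smul_right_injective M hc ((hzy i).trans (hzy j).symm)]
  exact hz j

end Module

/-! ### Eventually periodic sequences and functions with finite range. -/

theorem eventually_periodic_mul {β : Type*} {f : ℕ → β} {N d : ℕ}
    (h : ∀ n ≥ N, f (n + d) = f n) (m : ℕ) : ∀ n ≥ N, f (n + m * d) = f n := by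
  intro n hn
  induction m with
  | zero => simp
  | succ m ih => rw [Nat.succ_mul, ← add_assoc, h _ (by omega), ih]

/-- If finite-valued sequences are produced by a recursion with uniformly eventually periodic input,
then they are uniformly eventually periodic. -/
theorem exists_eventually_periodic {α Q C : Type*} (x : α → ℕ → Q) (c : α → ℕ → C)
    (G : Q → C → Q) (hx : ∀ i n, x i (n + 1) = G (x i n) (c i n)) {V : Set Q} (hV : V.Finite)
    (hxV : ∀ i n, x i n ∈ V) {N d : ℕ} (hd : 0 < d) (hc : ∀ i, ∀ n ≥ N, c i (n + d) = c i n) :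
    ∃ N' d', 0 < d' ∧ ∀ i, ∀ n ≥ N', x i (n + d') = x i n := by
  lift V to Finset Q using hV
  -- By pigeonhole two of the states at times `N + j d`, `0 ≤ j ≤ #V`, agree. The resulting period
  -- `(l - j) d` depends on `i`, but always divides `(#V)! d`.
  refine ⟨N + V.card * d, V.card.factorial * d, by positivity, fun i n hn => ?_⟩
  obtain ⟨j, hj, l, hl, hjl, hxjl⟩ := Finset.exists_ne_map_eq_of_card_lt_of_maps_to
    (s := Finset.range (V.card + 1)) (t := V) (by simp) (f := fun j => x i (N + j * d))
    (fun j _ => hxV i _)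
  wlog hlt : j < l generalizing j l
  · exact this l hl j hj hjl.symm hxjl.symm (by omega)
  -- The two times differ by a multiple of `d`, so equal states go on to receive equal inputs.
  have step (t : ℕ) : x i (N + j * d + t) = x i (N + l * d + t) := by
    induction t with
    | zero => exact hxjl
    | succ t ih =>
      rw [← add_assoc, ← add_assoc, hx, hx, ih, add_right_comm N (j * d),
        eventually_periodic_mul (hc i) j _ (by omega), add_right_comm N (l * d),
        eventually_periodic_mul (hc i) l _ (by omega)]
  have hlV : l ≤ V.card := by simpa [Nat.lt_succ_iff] using hl
  have hper : ∀ n ≥ N + j * d, x i (n + (l - j) * d) = x i n := by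
    intro n hn
    obtain ⟨t, rfl⟩ := Nat.exists_eq_add_of_le hn
    rw [step t]
    congr 1
    have : l * d = j * d + (l - j) * d := by rw [← add_mul]; congr 1; omega
    omega
  obtain ⟨m, hm⟩ := Nat.dvd_factorial (show 0 < l - j by omega) (show l - j ≤ V.card by omega)
  have := eventually_periodic_mul hper m n (hn.trans' (by gcongr; omega))
  rwa [← mul_assoc, mul_comm m, ← hm] at this

/-- The algebra of functions with finite range. -/
def finiteRange (R ι A : Type*) [CommRing R] [CommRing A] [Algebra R A] : Subalgebra R (ι → A) where
  carrier := {f | (Set.range f).Finite}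
  mul_mem' {f g} hf hg := (hf.mul hg).subset <| by
    rintro _ ⟨i, rfl⟩
    exact Set.mul_mem_mul ⟨i, rfl⟩ ⟨i, rfl⟩
  add_mem' {f g} hf hg := (hf.add hg).subset <| by
    rintro _ ⟨i, rfl⟩
    exact Set.add_mem_add ⟨i, rfl⟩ ⟨i, rfl⟩
  algebraMap_mem' r := (Set.finite_singleton (algebraMap R A r)).subset <| by
    rintro _ ⟨i, rfl⟩
    rfl

theorem mem_finiteRange {R ι A : Type*} [CommRing R] [CommRing A] [Algebra R A] {f : ι → A} :
    f ∈ finiteRange R ι A ↔ (Set.range f).Finite := Iff.rfl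

theorem mem_finiteRange_of_smul_eq {R ι A : Type*} [CommRing R] [IsDomain R] [CommRing A]
    [Algebra R A] [Module.IsTorsionFree R A] {f g : ι → A} (hg : g ∈ finiteRange R ι A) {b c : R}
    (hc : c ≠ 0) (h : c • f = b • g) : f ∈ finiteRange R ι A := by
  refine Set.Finite.of_finite_image (f := (c • ·)) ?_ (smul_right_injective A hc).injOn
  refine (hg.image (b • ·)).subset ?_
  rintro _ ⟨_, ⟨i, rfl⟩, rfl⟩
  exact ⟨g i, ⟨i, rfl⟩, (congrFun h i).symm⟩

/-! ### Separating finitely many elements of an integral extension modulo primes. -/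

section Separation

variable {R A : Type*} [CommRing R] [IsDedekindDomain R] [CommRing A] [IsDomain A] [Algebra R A]
  [Algebra.IsIntegral R A] [Module.IsTorsionFree R A]

theorem flat_of_isTorsionFree (R M : Type*) [CommRing R] [IsDedekindDomain R] [AddCommGroup M]
    [Module R M] [Module.IsTorsionFree R M] : Module.Flat R M :=
  IsDedekindDomain.flat_iff_torsion_eq_bot.mpr
    (Submodule.isTorsionFree_iff_torsion_eq_bot.mp inferInstance)

/-- A nonzero algebraic `v` divides some nonzero `c` of `R`, and `I A ∩ R = I` by faithful flatness.
This reduces divisibility questions in `A`, which need not be Noetherian, to the Dedekind domain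
`R`. -/
theorem exists_ne_zero_forall_mem_map {v : A} (hv : v ≠ 0) :
    ∃ c : R, c ≠ 0 ∧ ∀ I : Ideal R, v ∈ I.map (algebraMap R A) → c ∈ I := by
  have := flat_of_isTorsionFree R A
  obtain ⟨c, hc, hvc⟩ := (Algebra.IsIntegral.isIntegral (R := R) v).isAlgebraic.exists_nonzero_dvd
    (mem_nonZeroDivisors_of_ne_zero hv)
  refine ⟨c, hc, fun I hI => ?_⟩
  rw [← I.comap_map_eq_self_of_faithfullyFlat (B := A)]
  exact Ideal.mem_comap.mpr (Ideal.mem_of_dvd _ hvc hI)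

theorem exists_forall_notMem_map_pow (p : HeightOneSpectrum R) {D : Set A} (hD : D.Finite)
    (h0 : 0 ∉ D) : ∃ k, ∀ v ∈ D, v ∉ (p.asIdeal ^ k).map (algebraMap R A) := by
  have h1 (v : A) (hv : v ∈ D) : ∃ k, v ∉ (p.asIdeal ^ k).map (algebraMap R A) := by
    obtain ⟨c, hc, hcI⟩ := exists_ne_zero_forall_mem_map (R := R) (v := v) (fun h => h0 (h ▸ hv))
    by_contra! h
    have := Ideal.iInf_pow_eq_bot_of_isDomain p.asIdeal p.isPrime.ne_top
    exact hc (this.le (Submodule.mem_iInf _ |>.mpr fun k => hcI _ (h k)))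
  choose! k hk using h1
  obtain ⟨m, hm⟩ := (hD.image k).bddAbove
  exact ⟨m, fun v hv h => hk v hv (Ideal.map_mono (Ideal.pow_le_pow_right (hm ⟨v, hv, rfl⟩)) h)⟩

theorem finite_setOf_mem_map {D : Set A} (hD : D.Finite) (h0 : 0 ∉ D) :
    {p : HeightOneSpectrum R | ∃ v ∈ D, v ∈ p.asIdeal.map (algebraMap R A)}.Finite := by
  have h1 (v : A) (hv : v ∈ D) :
      {p : HeightOneSpectrum R | v ∈ p.asIdeal.map (algebraMap R A)}.Finite := by
    obtain ⟨c, hc, hcI⟩ := exists_ne_zero_forall_mem_map (R := R) (v := v) (fun h => h0 (h ▸ hv))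
    refine (Ideal.finite_factors (I := Ideal.span {c}) (by simpa using hc)).subset fun p hp => ?_
    exact Ideal.dvd_span_singleton.mpr (hcI _ hp)
  refine (hD.biUnion h1).subset ?_
  rintro p ⟨v, hv, hvp⟩
  exact Set.mem_biUnion hv hvp

end Separation

/-! ### Automatic Witt vectors are those with finitely many coefficients. -/

section Orbits

set_option linter.unusedSectionVars false

variable {R A : Type*} [CommRing R] [IsDedekindDomain R] [CommRing A] [Algebra R A]

@[simp]
theorem shift_apply (a b : NonzeroIdeal R) (η : NonzeroIdeal R → A) :
    shift A a η b = η (a * b) := rfl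

theorem shift_shift (a b : NonzeroIdeal R) (η : NonzeroIdeal R → A) :
    shift A a (shift A b η) = shift A (a * b) η := by
  rw [shift_mul, AlgHom.comp_apply]

theorem map_mem_smul {B C : Type*} [CommRing B] [Algebra R B] [CommRing C] [Algebra R C]
    {I : Ideal R} {U : Subalgebra R B} {V : Subalgebra R C} {f : B →ₐ[R] C}
    (h : ∀ x ∈ U, f x ∈ V) {x : B} (hx : x ∈ I • Subalgebra.toSubmodule U) :
    f x ∈ I • Subalgebra.toSubmodule V := by
  refine Submodule.smul_induction_on hx (fun r hr n hn => ?_) (fun a b ha hb => ?_)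
  · rw [map_smul]
    exact Submodule.smul_mem_smul hr (h n hn)
  · rw [map_add]
    exact add_mem ha hb

theorem shift_mem_finiteRange (a : NonzeroIdeal R) {η : NonzeroIdeal R → A}
    (h : η ∈ finiteRange R _ A) : shift A a η ∈ finiteRange R _ A :=
  Set.Finite.subset h <| by
    rintro _ ⟨b, rfl⟩
    exact ⟨a * b, rfl⟩

theorem closure_range_primeIdeal : Submonoid.closure (Set.range (primeIdeal (R := R))) = ⊤ := by
  rw [eq_top_iff]
  rintro ⟨a, ha⟩ -
  induction a using UniqueFactorizationMonoid.induction_on_prime with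
  | h₁ => simp at ha
  | h₂ a h =>
    have : (⟨a, ha⟩ : NonzeroIdeal R) = 1 := Subtype.ext ((Ideal.isUnit_iff.mp h).trans Ideal.one_eq_top.symm)
    rw [this]
    exact one_mem _
  | h₃ a p ha0 hp ih =>
    have hp' : p.IsPrime := Ideal.isPrime_of_prime hp
    have : (⟨p * a, ha⟩ : NonzeroIdeal R) =
        primeIdeal ⟨p, hp', hp.ne_zero⟩ * ⟨a, mem_nonZeroDivisors_of_ne_zero ha0⟩ := rfl
    rw [this]
    exact mul_mem (Submonoid.subset_closure ⟨_, rfl⟩) (ih _)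

theorem finite_image_shift_sup {M₁ M₂ : Submonoid (NonzeroIdeal R)} {η : NonzeroIdeal R → A}
    (h₁ : ((fun a => shift A a η) '' M₁).Finite)
    (h₂ : ∀ a ∈ M₁, ((fun b => shift A b (shift A a η)) '' M₂).Finite) :
    ((fun a => shift A a η) '' (M₁ ⊔ M₂ : Submonoid (NonzeroIdeal R))).Finite := by
  have := h₁.biUnion (t := fun θ => (fun b => shift A b θ) '' M₂) (by
    rintro _ ⟨a, ha, rfl⟩
    exact h₂ a ha)
  refine this.subset ?_
  rintro _ ⟨_, hc, rfl⟩
  obtain ⟨a, ha, b, hb, rfl⟩ := Submonoid.mem_sup.mp hc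
  exact Set.mem_biUnion ⟨a, ha, rfl⟩ ⟨b, hb, by simp only [shift_shift, mul_comm a b]⟩

/-- The states are the members of the orbit, a prime acts by its shift, and the output is the
coefficient at the unit ideal. -/
theorem isAutomatic_of_finite_orbit {η : NonzeroIdeal R → A}
    (h : (Set.range fun a => shift A a η).Finite) : IsAutomatic η := by
  set O := Set.range fun a => shift A a η
  have : Finite O := h
  -- The states of a `DFAO` lie in `Type`, whereas `O` lives in the universes of `R` and `A`; hence
  -- the transport to `Fin n`.
  obtain ⟨n, ⟨e⟩⟩ := Finite.exists_equiv_fin O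
  let step (s : O) (p : HeightOneSpectrum R) : O := ⟨shift A (primeIdeal p) s, by
    obtain ⟨_, a, rfl⟩ := s
    exact ⟨primeIdeal p * a, (shift_shift _ _ _).symm⟩⟩
  refine ⟨⟨Fin n, inferInstance, fun s p => e (step (e.symm s) p), e ⟨η, 1, by ext; simp⟩,
    fun s => (e.symm s : NonzeroIdeal R → A) 1⟩, fun u => ?_⟩
  have key (u : List (HeightOneSpectrum R)) (s : O) :
      (e.symm (u.foldl (fun s p => e (step (e.symm s) p)) (e s)) : NonzeroIdeal R → A) =
        shift A (u.map primeIdeal).prod s := by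
    induction u generalizing s with
    | nil => ext; simp
    | cons p u ih =>
      rw [List.foldl_cons, e.symm_apply_apply, ih, List.map_cons, List.prod_cons, mul_comm,
        ← shift_shift]
  simp only [DFAO.eval, key, shift_apply, mul_one]

theorem IsAutomatic.finite_range {η : NonzeroIdeal R → A} (h : IsAutomatic η) :
    (Set.range η).Finite := by
  obtain ⟨M, hM⟩ := h
  have := M.finite
  refine (Set.finite_range M.output).subset ?_
  rintro _ ⟨a, rfl⟩
  obtain ⟨l, hl, rfl⟩ := Submonoid.exists_list_of_mem_closure
    (closure_range_primeIdeal (R := R) ▸ Submonoid.mem_top a)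
  obtain ⟨u, rfl⟩ : l ∈ Set.range (List.map primeIdeal) := by
    rwa [Set.range_list_map]
  exact ⟨_, (hM u).symm⟩

/-- The nonzero differences of the values of a function. -/
def valueDifferences {ι : Type*} (η : ι → A) : Set A :=
  {v | v ≠ 0 ∧ ∃ i j, η i - η j = v}

theorem finite_valueDifferences {ι : Type*} {η : ι → A} (h : (Set.range η).Finite) :
    (valueDifferences η).Finite := by
  refine (h.sub h).subset ?_
  rintro _ ⟨-, i, j, rfl⟩
  exact Set.sub_mem_sub ⟨i, rfl⟩ ⟨j, rfl⟩

/-- The sequence `ψ_p^n ξ` is eventually periodic modulo the ideal `J` of the coefficient ring. -/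
def EventuallyPeriodicMod (p : HeightOneSpectrum R) (J : Ideal A) (η : NonzeroIdeal R → A) : Prop :=
  ∃ N d, 0 < d ∧ ∀ n ≥ N, ∀ a, η (primeIdeal p ^ (n + d) * a) - η (primeIdeal p ^ n * a) ∈ J

theorem EventuallyPeriodicMod.add {p : HeightOneSpectrum R} {J : Ideal A}
    {η θ : NonzeroIdeal R → A} (hη : EventuallyPeriodicMod p J η)
    (hθ : EventuallyPeriodicMod p J θ) : EventuallyPeriodicMod p J (η + θ) := by
  obtain ⟨N, d, hd, h⟩ := hη
  obtain ⟨M, e, he, h'⟩ := hθ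
  refine ⟨max N M, e * d, by positivity, fun n hn a => ?_⟩
  have h1 := eventually_periodic_mul
    (f := fun n => Ideal.Quotient.mk J (η (primeIdeal p ^ n * a)))
    (fun n hn => (Ideal.Quotient.mk_eq_mk_iff_sub_mem _ _).mpr (h n hn a)) e n (by omega)
  have h2 := eventually_periodic_mul
    (f := fun n => Ideal.Quotient.mk J (θ (primeIdeal p ^ n * a)))
    (fun n hn => (Ideal.Quotient.mk_eq_mk_iff_sub_mem _ _).mpr (h' n hn a)) d n (by omega)
  rw [mul_comm d e] at h2
  rw [← Ideal.Quotient.mk_eq_mk_iff_sub_mem, Pi.add_apply, Pi.add_apply, map_add, map_add]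
  exact congrArg₂ _ h1 h2

variable [Ring.HasFiniteQuotients R]

theorem shift_mem_U (n : ℕ) (a : NonzeroIdeal R) {η : NonzeroIdeal R → A} (h : η ∈ U R A n) :
    shift A a η ∈ U R A n := by
  induction n generalizing η with
  | zero => trivial
  | succ n ih =>
    refine ⟨ih h.1, fun p => ?_⟩
    rw [shift_shift, mul_comm, ← shift_shift, ← map_pow, ← map_sub]
    exact map_mem_smul (fun x hx => ih hx) (h.2 p)

theorem mem_W {η : NonzeroIdeal R → A} : η ∈ W R A ↔ ∀ n, η ∈ U R A n := Algebra.mem_iInf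

theorem shift_mem_W (a : NonzeroIdeal R) {η : NonzeroIdeal R → A} (h : η ∈ W R A) :
    shift A a η ∈ W R A :=
  mem_W.mpr fun n => shift_mem_U n a (mem_W.mp h n)

variable (R A) in
/-- The ring of Witt vectors with finitely many distinct coefficients. -/
def finiteW : Subalgebra R (NonzeroIdeal R → A) := W R A ⊓ finiteRange R _ A

theorem shift_mem_finiteW (a : NonzeroIdeal R) {η : NonzeroIdeal R → A} (h : η ∈ finiteW R A) :
    shift A a η ∈ finiteW R A :=
  ⟨shift_mem_W a h.1, shift_mem_finiteRange a h.2⟩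

variable [IsDomain A] [Module.IsTorsionFree R A]

/-- The definition gives membership in each `p U_n` separately; `mem_ideal_smul_iInf` combines these
into `p W`. -/
theorem shift_sub_pow_mem_W (p : HeightOneSpectrum R) {η : NonzeroIdeal R → A} (h : η ∈ W R A) :
    shift A (primeIdeal p) η - η ^ residueCard p ∈ p.asIdeal • Subalgebra.toSubmodule (W R A) := by
  have : Subalgebra.toSubmodule (W R A) = ⨅ n, Subalgebra.toSubmodule (U R A n) := by
    ext x
    simp [mem_W, Submodule.mem_iInf]
  rw [this]
  exact mem_ideal_smul_iInf p.ne_bot fun n => (mem_W.mp h (n + 1)).2 p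

theorem shift_sub_pow_mem_finiteW (p : HeightOneSpectrum R) {η : NonzeroIdeal R → A}
    (h : η ∈ finiteW R A) : shift A (primeIdeal p) η - η ^ residueCard p ∈
      p.asIdeal • Subalgebra.toSubmodule (finiteW R A) := by
  obtain ⟨hW, hF⟩ := Algebra.mem_inf.mp h
  have hmem := shift_sub_pow_mem_W p hW
  rw [mem_ideal_smul_iff p.ne_bot] at hmem ⊢
  intro b c hc hbc
  obtain ⟨z, hz, hzy⟩ := hmem b c hc hbc
  have hy : shift A (primeIdeal p) η - η ^ residueCard p ∈ finiteRange R _ A :=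
    Subalgebra.sub_mem _ (shift_mem_finiteRange _ hF) (Subalgebra.pow_mem _ hF _)
  exact ⟨z, Algebra.mem_inf.mpr ⟨hz, mem_finiteRange_of_smul_eq hy hc hzy⟩, hzy⟩

/-- The error `θ = ψ_p η - η ^ #k_p` is a sum of terms `r ζ` with `r ∈ p`, so periodicity of the `ζ`
modulo `p ^ k` gives that of `θ` modulo `p ^ (k + 1)`. Then `x ↦ x ^ #k_p + c` is a finite-valued
recursion with periodic input `c`, uniformly in the index `a`. -/
theorem eventuallyPeriodicMod_pow (p : HeightOneSpectrum R) (k : ℕ) {η : NonzeroIdeal R → A}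
    (hη : η ∈ finiteW R A) :
    EventuallyPeriodicMod p ((p.asIdeal ^ k).map (algebraMap R A)) η := by
  induction k generalizing η with
  | zero => exact ⟨0, 1, one_pos, fun n _ a => by simp [Ideal.one_eq_top, Ideal.map_top]⟩
  | succ k ih =>
    set J := (p.asIdeal ^ (k + 1)).map (algebraMap R A)
    have hθ : EventuallyPeriodicMod p J (shift A (primeIdeal p) η - η ^ residueCard p) := by
      refine Submodule.smul_induction_on (shift_sub_pow_mem_finiteW p hη) (fun r hr ζ hζ => ?_)
        (fun x y hx hy => hx.add hy)
      obtain ⟨N, d, hd, h⟩ := ih hζ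
      refine ⟨N, d, hd, fun n hn a => ?_⟩
      rw [Pi.smul_apply, Pi.smul_apply, ← smul_sub, Algebra.smul_def]
      simp only [J, pow_succ', Ideal.map_mul]
      exact Ideal.mul_mem_mul (Ideal.mem_map_of_mem _ hr) (h n hn a)
    obtain ⟨N, d, hd, h⟩ := hθ
    obtain ⟨N', d', hd', h'⟩ := exists_eventually_periodic
      (fun a n => Ideal.Quotient.mk J (η (primeIdeal p ^ n * a)))
      (fun a n => Ideal.Quotient.mk J
        ((shift A (primeIdeal p) η - η ^ residueCard p) (primeIdeal p ^ n * a)))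
      (fun x c => x ^ residueCard p + c)
      (fun a n => by simp [pow_succ', mul_assoc])
      ((mem_finiteRange.mp hη.2).image (Ideal.Quotient.mk J)) (fun a n => ⟨_, ⟨_, rfl⟩, rfl⟩) hd
      (fun a n hn => (Ideal.Quotient.mk_eq_mk_iff_sub_mem _ _).mpr (h n hn a))
    exact ⟨N', d', hd', fun n hn a => (Ideal.Quotient.mk_eq_mk_iff_sub_mem _ _).mp (h' a n hn)⟩

variable [Algebra.IsIntegral R A]

theorem finite_range_shift_pow (p : HeightOneSpectrum R) {η : NonzeroIdeal R → A}
    (hη : η ∈ finiteW R A) : (Set.range fun n : ℕ => shift A (primeIdeal p ^ n) η).Finite := by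
  obtain ⟨k, hk⟩ := exists_forall_notMem_map_pow p (finite_valueDifferences hη.2)
    (fun h => h.1 rfl)
  obtain ⟨N, d, hd, h⟩ := eventuallyPeriodicMod_pow p k hη
  have hper : ∀ n ≥ N, shift A (primeIdeal p ^ (n + d)) η = shift A (primeIdeal p ^ n) η := by
    intro n hn
    ext a
    by_contra hne
    exact hk _ ⟨sub_ne_zero.mpr hne, _, _, rfl⟩ (h n hn a)
  refine ((Set.finite_Iio (N + d)).image fun n : ℕ => shift A (primeIdeal p ^ n) η).subset ?_
  rintro _ ⟨n, rfl⟩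
  induction n using Nat.strong_induction_on with
  | _ n ih =>
    by_cases hn : n < N + d
    · exact ⟨n, hn, rfl⟩
    · have := hper (n - d) (by omega)
      rw [Nat.sub_add_cancel (by omega)] at this
      simpa only [this] using ih (n - d) (by omega)

theorem finite_image_shift_closure {S : Set (HeightOneSpectrum R)} (hS : S.Finite)
    {η : NonzeroIdeal R → A} (hη : η ∈ finiteW R A) :
    ((fun a => shift A a η) '' Submonoid.closure (primeIdeal '' S)).Finite := by
  induction S, hS using Set.Finite.induction_on generalizing η with
  | empty => simp
  | @insert p S _ _ ih =>
    rw [Set.image_insert_eq, ← Set.singleton_union, Submonoid.closure_union]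
    refine finite_image_shift_sup ?_ fun a _ => ih (shift_mem_finiteW a hη)
    refine (finite_range_shift_pow p hη).subset ?_
    rintro _ ⟨_, ha, rfl⟩
    obtain ⟨n, rfl⟩ := Submonoid.mem_closure_singleton.mp ha
    exact ⟨n, rfl⟩

/-- If `η a = η b`, then `η (p a)` and `η (p b)` are congruent modulo `p` to the same power, hence
equal because no nonzero difference of values lies in `p A`. -/
theorem exists_shift_eq_comp (p : HeightOneSpectrum R) {η : NonzeroIdeal R → A} (hη : η ∈ W R A)
    (hp : ∀ v ∈ valueDifferences η, v ∉ p.asIdeal.map (algebraMap R A)) :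
    ∃ g : A → A, shift A (primeIdeal p) η = g ∘ η := by
  have hmem (a) : η (primeIdeal p * a) - η a ^ residueCard p ∈ p.asIdeal.map (algebraMap R A) := by
    have h (x : NonzeroIdeal R → A) (hx : x ∈ p.asIdeal • Subalgebra.toSubmodule (W R A)) :
        x a ∈ p.asIdeal.map (algebraMap R A) := by
      refine Submodule.smul_induction_on hx (fun r hr n hn => ?_) (fun a b ha hb => add_mem ha hb)
      rw [Pi.smul_apply, Algebra.smul_def]
      exact Ideal.mul_mem_right _ _ (Ideal.mem_map_of_mem _ hr)
    exact h _ (shift_sub_pow_mem_W p hη)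
  have hfac : Function.FactorsThrough (shift A (primeIdeal p) η) η := by
    intro a b hab
    by_contra hne
    refine hp _ ⟨sub_ne_zero.mpr hne, _, _, rfl⟩ ?_
    have := sub_mem (hmem a) (hmem b)
    rwa [hab, sub_sub_sub_cancel_right] at this
  exact ⟨Function.extend η (shift A (primeIdeal p) η) id, (hfac.extend_comp id).symm⟩

/-- A Witt vector with finitely many distinct coefficients has a finite orbit. -/
theorem finite_orbit {η : NonzeroIdeal R → A} (hη : η ∈ finiteW R A) :
    (Set.range fun a => shift A a η).Finite := by
  set S := {p : HeightOneSpectrum R |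
    ∃ v ∈ valueDifferences η, v ∈ p.asIdeal.map (algebraMap R A)}
  have hS : S.Finite := finite_setOf_mem_map (finite_valueDifferences hη.2) (fun h => h.1 rfl)
  have htop : Submonoid.closure (primeIdeal '' Sᶜ) ⊔ Submonoid.closure (primeIdeal '' S) = ⊤ := by
    rw [← Submonoid.closure_union, ← Set.image_union, Set.compl_union_self, Set.image_univ,
      closure_range_primeIdeal]
  have hcomp (a) (ha : a ∈ Submonoid.closure (primeIdeal '' Sᶜ)) :
      ∃ g : A → A, shift A a η = g ∘ η := by
    induction ha using Submonoid.closure_induction with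
    | mem _ hp =>
      obtain ⟨p, hp, rfl⟩ := hp
      exact exists_shift_eq_comp p hη.1 fun v hv hvp => hp ⟨v, hv, hvp⟩
    | one => exact ⟨id, by ext; simp⟩
    | mul a b _ _ ha hb =>
      obtain ⟨g, hg⟩ := ha
      obtain ⟨h, hh⟩ := hb
      refine ⟨h ∘ g, ?_⟩
      rw [← shift_shift, hh]
      ext c
      exact congrArg h (congrFun hg c)
  have hgood : ((fun a => shift A a η) '' Submonoid.closure (primeIdeal '' Sᶜ)).Finite := by
    have : Finite (Set.range η) := hη.2
    -- Each such shift is `g ∘ η` with `g` mapping the finite set of values to itself, and there are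
    -- finitely many such maps.
    refine (Set.finite_range fun (g : Set.range η → Set.range η) (a : NonzeroIdeal R) =>
      (g ⟨η a, a, rfl⟩ : A)).subset ?_
    rintro _ ⟨a, ha, rfl⟩
    obtain ⟨g, hg⟩ := hcomp a ha
    refine ⟨fun v => ⟨g v, ?_⟩, hg.symm⟩
    obtain ⟨_, b, rfl⟩ := v
    exact ⟨a * b, congrFun hg b⟩
  have := finite_image_shift_sup hgood fun a _ =>
    finite_image_shift_closure hS (shift_mem_finiteW a hη)
  rwa [htop, Submonoid.coe_top, Set.image_univ] at this

/-- A Witt vector is automatic if and only if it has finitely many distinct coefficients. -/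
theorem Wa_eq_finiteW : Wa R A = finiteW R A := by
  ext η
  exact ⟨fun h => ⟨h.1, h.2.finite_range⟩,
    fun h => ⟨h.1, isAutomatic_of_finite_orbit (finite_orbit h)⟩⟩

end Orbits

/-! ### Étale algebras, clearing denominators, and integrality. -/

/-- A reduced Artinian ring is the product of its residue fields, which are separable over a perfect
field. -/
theorem etale_of_finite_of_isReduced (K X : Type*) [Field K] [PerfectField K] [CommRing X]
    [Algebra K X] [Module.Finite K X] [IsReduced X] : Algebra.Etale K X := by
  have : IsArtinianRing X := .of_finite K X
  let _ (m : MaximalSpectrum X) : Field (X ⧸ m.asIdeal) := Ideal.Quotient.field _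
  exact Algebra.Etale.iff_exists_algEquiv_prod K X |>.mpr ⟨MaximalSpectrum X, inferInstance,
    fun m => X ⧸ m.asIdeal, inferInstance, inferInstance,
    (IsArtinianRing.equivPi X).restrictScalars K, fun m => ⟨inferInstance, inferInstance⟩⟩

section Tensor

set_option linter.overlappingInstances false
set_option linter.unusedSectionVars false

variable (R K : Type*) [CommRing R] [IsDomain R] [Field K] [Algebra R K] [IsFractionRing R K]

theorem exists_smul_eq_one_tmul {M : Type*} [AddCommGroup M] [Module R M] (x : K ⊗[R] M) :
    ∃ c : R, c ≠ 0 ∧ ∃ m : M, c • x = 1 ⊗ₜ m := by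
  induction x with
  | zero => exact ⟨1, one_ne_zero, 0, by simp⟩
  | tmul k m =>
    obtain ⟨a, c, hc, rfl⟩ := IsFractionRing.div_surjective (A := R) k
    have hc' : algebraMap R K c ≠ 0 := IsFractionRing.to_map_ne_zero_of_mem_nonZeroDivisors hc
    refine ⟨c, nonZeroDivisors.ne_zero hc, a • m, ?_⟩
    rw [TensorProduct.smul_tmul', Algebra.smul_def, mul_div_cancel₀ _ hc',
      TensorProduct.tmul_smul, TensorProduct.smul_tmul', Algebra.smul_def, mul_one]
  | add x y hx hy =>
    obtain ⟨c, hc, m, hm⟩ := hx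
    obtain ⟨d, hd, n, hn⟩ := hy
    refine ⟨c * d, mul_ne_zero hc hd, d • m + c • n, ?_⟩
    rw [smul_add, mul_comm c d, mul_smul, hm, mul_comm d c, mul_smul, hn, TensorProduct.tmul_add,
      TensorProduct.tmul_smul, TensorProduct.tmul_smul]

variable {R K} in
theorem eq_zero_of_smul_eq_zero_of_vectorSpace {X : Type*} [AddCommGroup X] [Module R X]
    [Module K X] [IsScalarTower R K X] {c : R} (hc : c ≠ 0) {x : X} (h : c • x = 0) : x = 0 := by
  rw [← algebraMap_smul K c x] at h
  exact (smul_eq_zero.mp h).resolve_left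
    ((map_ne_zero_iff _ (IsFractionRing.injective R K)).mpr hc)

theorem isTorsionFree_of_vectorSpace (X : Type*) [AddCommGroup X] [Module R X]
    [Module K X] [IsScalarTower R K X] : Module.IsTorsionFree R X :=
  Module.IsTorsionFree.trans_faithfulSMul R K X

/-- A subalgebra spanning a `K`-algebra `X` up to denominators satisfies `K ⊗ B ≃ X`. -/
theorem bijective_productMap_val {X : Type*} [CommRing X] [Algebra R X] [Algebra K X]
    [IsScalarTower R K X] (B : Subalgebra R X) (h : ∀ x : X, ∃ c : R, c ≠ 0 ∧ c • x ∈ B) :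
    Function.Bijective
      (Algebra.TensorProduct.productMap (IsScalarTower.toAlgHom R K X) B.val) := by
  constructor
  · rw [injective_iff_map_eq_zero]
    intro z hz
    obtain ⟨c, hc, b, hb⟩ := exists_smul_eq_one_tmul R K z
    have hb0 : b = 0 := by
      have := congrArg (Algebra.TensorProduct.productMap (IsScalarTower.toAlgHom R K X) B.val) hb
      rw [map_smul, hz, smul_zero, Algebra.TensorProduct.productMap_apply_tmul, map_one,
        one_mul] at this
      exact Subtype.ext this.symm
    rw [hb0, TensorProduct.tmul_zero] at hb
    exact eq_zero_of_smul_eq_zero_of_vectorSpace (K := K) hc hb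
  · intro x
    obtain ⟨c, hc, hx⟩ := h x
    have hc' : algebraMap R K c ≠ 0 := (map_ne_zero_iff _ (IsFractionRing.injective R K)).mpr hc
    refine ⟨(algebraMap R K c)⁻¹ ⊗ₜ ⟨c • x, hx⟩, ?_⟩
    rw [Algebra.TensorProduct.productMap_apply_tmul, IsScalarTower.coe_toAlgHom',
      ← Algebra.smul_def]
    change (algebraMap R K c)⁻¹ • c • x = x
    rw [← algebraMap_smul K c x, inv_smul_smul₀ hc']

/-- The integral closure of a Dedekind domain in a finite étale algebra is finite. -/
theorem finite_of_forall_isIntegral [IsDedekindDomain R] {X : Type*} [CommRing X] [Algebra R X]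
    [Algebra K X] [IsScalarTower R K X] [Algebra.Etale K X] (B : Subalgebra R X)
    (hB : ∀ x ∈ B, IsIntegral R x) : Module.Finite R B := by
  obtain ⟨I, _, E, _, _, e, he⟩ := (Algebra.Etale.iff_exists_algEquiv_prod K X).mp ‹_›
  let _ (i : I) : Algebra R (E i) := Algebra.compHom (E i) (algebraMap R K)
  have (i : I) : IsScalarTower R K (E i) := .of_algebraMap_eq fun _ => rfl
  have (i : I) : IsNoetherian R (integralClosure R (E i)) := by
    have := (he i).1
    have := (he i).2
    exact IsIntegralClosure.isNoetherian R K (E i) _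
  let f (i : I) : X →ₐ[R] E i := ((Pi.evalAlgHom K E i).comp e.toAlgHom).restrictScalars R
  -- `B` embeds into a finite product of integral closures of `R` in finite separable extensions,
  -- each a Noetherian module.
  let g : B →ₗ[R] Π i, integralClosure R (E i) := LinearMap.pi fun i =>
    (((f i).comp B.val).codRestrict (integralClosure R (E i))
      fun b => (hB b b.2).map (f i)).toLinearMap
  have hg : Function.Injective g := by
    intro x y hxy
    refine Subtype.ext (e.injective ?_)
    ext i
    exact congrArg Subtype.val (congrFun hxy i)
  exact Module.Finite.of_injective g hg

end Tensor

/-- The product of monic equations for the finitely many values annihilates every coordinate at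
once. -/
theorem isIntegral_of_finite_range {R ι A : Type*} [CommRing R] [CommRing A] [Algebra R A]
    {f : ι → A} (hf : (Set.range f).Finite) (h : ∀ i, IsIntegral R (f i)) : IsIntegral R f := by
  choose P hP hPf using h
  lift Set.range f to Finset A using hf with V hV
  have hV' i : f i ∈ V := by
    rw [← Finset.mem_coe, hV]
    exact ⟨i, rfl⟩
  have h' (v : V) : ∃ Q : Polynomial R, Q.Monic ∧ Polynomial.aeval (v : A) Q = 0 := by
    obtain ⟨i, hi⟩ : (v : A) ∈ Set.range f := hV ▸ v.2
    exact ⟨P i, hP i, hi ▸ hPf i⟩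
  choose Q hQ hQv using h'
  refine ⟨∏ v, Q v, Polynomial.monic_prod_of_monic _ _ fun v _ => hQ v, ?_⟩
  ext i
  have : Polynomial.aeval (f i) (∏ v, Q v) = 0 := by
    rw [map_prod]
    exact Finset.prod_eq_zero (Finset.mem_univ ⟨f i, hV' i⟩) (hQv ⟨f i, hV' i⟩)
  rw [← Polynomial.aeval_def]
  exact (Polynomial.aeval_algHom_apply (Pi.evalAlgHom R (fun _ : ι => A) i) f _).symm.trans this

theorem finite_range_of_isIntegral {R ι A : Type*} [CommRing R] [CommRing A] [IsDomain A]
    [Algebra R A] [FaithfulSMul R A] {f : ι → A} (h : IsIntegral R f) : (Set.range f).Finite := by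
  obtain ⟨P, hP, hPf⟩ := h
  refine (P.rootSet_finite A).subset ?_
  rintro _ ⟨i, rfl⟩
  refine Polynomial.mem_rootSet'.mpr ⟨(hP.map _).ne_zero, ?_⟩
  rw [← Polynomial.aeval_def] at hPf
  exact (Polynomial.aeval_algHom_apply (Pi.evalAlgHom R (fun _ : ι => A) i) f P).trans
    (congrFun hPf i)

/-! ### The maximal integral model. -/

section Model

set_option linter.unusedSectionVars false

variable {R : Type*} [CommRing R] [IsDedekindDomain R] [Ring.HasFiniteQuotients R]
  {A : Type*} [CommRing A] [Algebra R A]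
  {K : Type*} [Field K] [Algebra R K] [IsFractionRing R K]
  {L : Type*} [Field L] [Algebra K L] [Algebra R L] [IsScalarTower R K L] [Algebra A L]
  [IsScalarTower R A L]

variable (R A L) in
/-- The coefficientwise inclusion `A^{I_K} → L^{I_K}`. -/
abbrev coeffMap : (NonzeroIdeal R → A) →ₐ[R] (NonzeroIdeal R → L) :=
  (IsScalarTower.toAlgHom R A L).compLeft (NonzeroIdeal R)

theorem coeffMap_injective [FaithfulSMul A L] : Function.Injective (coeffMap R A L) :=
  (FaithfulSMul.algebraMap_injective A L).comp_left

theorem toProduct_one_tmul (ξ : W R A) (b : orbitAlgebra ξ) :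
    toProduct K L ξ (1 ⊗ₜ b) = coeffMap R A L b := by
  simp [toProduct]

theorem toProduct_injective [FaithfulSMul A L] (ξ : W R A) :
    Function.Injective (toProduct K L ξ) := by
  rw [injective_iff_map_eq_zero]
  intro z hz
  obtain ⟨c, hc, b, hb⟩ := exists_smul_eq_one_tmul R K z
  have hb0 : b = 0 := by
    have := congrArg (toProduct K L ξ) hb
    rw [map_smul, hz, smul_zero, toProduct_one_tmul] at this
    exact Subtype.ext (coeffMap_injective (this.symm.trans (map_zero _).symm))
  rw [hb0, TensorProduct.tmul_zero] at hb
  exact eq_zero_of_smul_eq_zero_of_vectorSpace (K := K) hc hb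

theorem toProduct_tensorPsi (ξ : W R A) (p : HeightOneSpectrum R) (x : K ⊗[R] orbitAlgebra ξ) :
    toProduct K L ξ (tensorPsi K ξ p x) = shift L (primeIdeal p) (toProduct K L ξ x) := by
  have : (toProduct K L ξ).comp (tensorPsi K ξ p) =
      (shift L (primeIdeal p)).comp (toProduct K L ξ) := by
    refine Algebra.TensorProduct.ext ?_ ?_
    · ext k a
      simp [toProduct, tensorPsi]
    · ext b a
      simp [toProduct, tensorPsi, orbitPsi]
      rfl
  exact DFunLike.congr_fun this x

theorem shift_coeffMap (a : NonzeroIdeal R) (η : NonzeroIdeal R → A) :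
    shift L a (coeffMap R A L η) = coeffMap R A L (shift A a η) := rfl

theorem isSubLambdaRing_of_isTorsionFree {X : Type*} [CommRing X] [Algebra R X]
    [Module.IsTorsionFree R X] {ψ : HeightOneSpectrum R → X →ₐ[R] X}
    (hψ : ∀ p q, (ψ p).comp (ψ q) = (ψ q).comp (ψ p)) {B : Subalgebra R X}
    (h : ∀ p, ∀ b ∈ B, ψ p b ∈ B)
    (hB : ∀ p, ∀ b ∈ B, ψ p b - b ^ residueCard p ∈ p.asIdeal • Subalgebra.toSubmodule B) :
    IsSubLambdaRing ψ B := by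
  refine ⟨fun p b => h p b b.2, ?_, fun p q => ?_, fun p b => ?_⟩
  · exact flat_of_isTorsionFree R B
  · ext b
    exact DFunLike.congr_fun (hψ p q) (b : X)
  · obtain ⟨z, hz⟩ : ∃ z ∈ p.asIdeal.map (algebraMap R B),
        (z : X) = ψ p b - (b : X) ^ residueCard p := by
      refine Submodule.smul_induction_on (hB p b b.2) (fun r hr n hn => ?_) ?_
      · refine ⟨r • ⟨n, hn⟩, ?_, rfl⟩
        rw [Algebra.smul_def]
        exact Ideal.mul_mem_right _ _ (Ideal.mem_map_of_mem _ hr)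
      · rintro x y ⟨z, hz, rfl⟩ ⟨w, hw, rfl⟩
        exact ⟨z + w, add_mem hz hw, rfl⟩
    convert hz.1
    exact Subtype.ext hz.2.symm

theorem IsSubLambdaRing.sub_pow_mem {X : Type*} [CommRing X] [Algebra R X]
    {ψ : HeightOneSpectrum R → X →ₐ[R] X} {B : Subalgebra R X} (hB : IsSubLambdaRing ψ B)
    (p : HeightOneSpectrum R) {b : X} (hb : b ∈ B) :
    ψ p b - b ^ residueCard p ∈ p.asIdeal • Subalgebra.toSubmodule B := by
  obtain ⟨_, hB⟩ := hB
  have := hB.frobenius p ⟨b, hb⟩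
  have key (x : B) (hx : x ∈ p.asIdeal.map (algebraMap R B)) :
      (x : X) ∈ p.asIdeal • Subalgebra.toSubmodule B := by
    refine Submodule.span_induction ?_ (zero_mem _) (fun x y _ _ => add_mem) ?_ hx
    · rintro _ ⟨r, hr, rfl⟩
      rw [Subalgebra.coe_algebraMap, Algebra.algebraMap_eq_smul_one]
      exact Submodule.smul_mem_smul hr B.one_mem
    · intro y x _ h
      exact mul_mem_smul _ B y.2 h
  exact key _ this

variable [IsDomain A] [Module.IsTorsionFree R A] [Algebra.IsIntegral R A]

theorem mem_maximalModel {ξ : W R A} {x : K ⊗[R] orbitAlgebra ξ} :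
    x ∈ maximalModel K L ξ ↔ ∃ η ∈ finiteW R A, coeffMap R A L η = toProduct K L ξ x := by
  rw [maximalModel, Subalgebra.mem_comap, Subalgebra.mem_map, Wa_eq_finiteW]

variable {ξ : W R A} (hξ : IsIntegral R ξ)
include hξ

theorem isIntegral_shift (a : NonzeroIdeal R) :
    IsIntegral R (shift A a (ξ : NonzeroIdeal R → A)) :=
  hξ.map ((shift A a).comp (W R A).val)

theorem mem_finiteW_of_isIntegral : (ξ : NonzeroIdeal R → A) ∈ finiteW R A :=
  Algebra.mem_inf.mpr ⟨ξ.2, finite_range_of_isIntegral (hξ.map (W R A).val)⟩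

theorem finite_orbitAlgebra : Module.Finite R (orbitAlgebra ξ) := by
  refine Module.Finite.iff_fg.mpr (fg_adjoin_of_finite
    (finite_orbit (mem_finiteW_of_isIntegral hξ)) ?_)
  rintro _ ⟨a, rfl⟩
  exact isIntegral_shift hξ a

theorem orbitAlgebra_le_finiteW : orbitAlgebra ξ ≤ finiteW R A := by
  refine Algebra.adjoin_le ?_
  rintro _ ⟨a, rfl⟩
  exact shift_mem_finiteW a (mem_finiteW_of_isIntegral hξ)

omit hξ in
theorem isReduced_tensor_orbitAlgebra [FaithfulSMul A L] : IsReduced (K ⊗[R] orbitAlgebra ξ) :=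
  isReduced_of_injective (toProduct K L ξ) (toProduct_injective ξ)

omit hξ in
theorem tensorPsi_comm (p q : HeightOneSpectrum R) :
    (tensorPsi K ξ p).comp (tensorPsi K ξ q) = (tensorPsi K ξ q).comp (tensorPsi K ξ p) := by
  have (a b : NonzeroIdeal R) (η : NonzeroIdeal R → A) :
      shift A a (shift A b η) = shift A b (shift A a η) := by
    rw [shift_shift, shift_shift, mul_comm]
  refine Algebra.TensorProduct.ext (by ext; simp [tensorPsi]) ?_
  ext b : 1
  simp only [tensorPsi, AlgHom.coe_comp, AlgHom.coe_restrictScalars', Function.comp_apply,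
    Algebra.TensorProduct.includeRight_apply, Algebra.TensorProduct.map_tmul, map_one]
  exact congrArg _ (Subtype.ext (this _ _ _))

-- A nonzero prime of `R` generates the unit ideal in a `K`-algebra, so the Frobenius congruence is
-- vacuous.
omit hξ in
theorem isLambdaRing_tensorPsi :
    IsLambdaRing R (K ⊗[R] orbitAlgebra ξ) (tensorPsi K ξ) where
  flat := by
    have := isTorsionFree_of_vectorSpace R K (K ⊗[R] orbitAlgebra ξ)
    exact flat_of_isTorsionFree R _
  comm := tensorPsi_comm
  frobenius p a := by
    obtain ⟨c, hc, hc0⟩ := Submodule.exists_mem_ne_zero_of_ne_bot p.ne_bot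
    have hu : IsUnit (algebraMap R (K ⊗[R] orbitAlgebra ξ) c) := by
      rw [IsScalarTower.algebraMap_apply R K]
      exact (IsUnit.mk0 _ ((map_ne_zero_iff _ (IsFractionRing.injective R K)).mpr hc0)).map _
    rw [Ideal.eq_top_of_isUnit_mem _ (Ideal.mem_map_of_mem _ hc) hu]
    trivial

-- The Frobenius congruence holds in `finiteW`. It transfers through the criterion
-- `mem_ideal_smul_iff`, since the quotients by `c` that the criterion requires exist in the
-- `K`-algebra `X`.
omit hξ in
theorem isSubLambdaRing_maximalModel :
    IsSubLambdaRing (tensorPsi K ξ) (maximalModel K L ξ) := by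
  have := isTorsionFree_of_vectorSpace R K (K ⊗[R] orbitAlgebra ξ)
  have := isTorsionFree_of_vectorSpace R K (NonzeroIdeal R → L)
  refine isSubLambdaRing_of_isTorsionFree tensorPsi_comm (fun p x hx => ?_) (fun p x hx => ?_)
  · obtain ⟨η, hη, hηx⟩ := mem_maximalModel.mp hx
    exact mem_maximalModel.mpr ⟨shift A (primeIdeal p) η, shift_mem_finiteW _ hη, by
      rw [toProduct_tensorPsi, ← hηx, shift_coeffMap]⟩
  · obtain ⟨η, hη, hηx⟩ := mem_maximalModel.mp hx
    have hθ := shift_sub_pow_mem_finiteW p hη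
    rw [mem_ideal_smul_iff p.ne_bot] at hθ ⊢
    intro b c hc hbc
    obtain ⟨z, hz, hzθ⟩ := hθ b c hc hbc
    have hc' : algebraMap R K c ≠ 0 := (map_ne_zero_iff _ (IsFractionRing.injective R K)).mpr hc
    set y := tensorPsi K ξ p x - x ^ residueCard p with hy
    have hcy : c • (algebraMap R K c)⁻¹ • b • y = b • y := by
      rw [← algebraMap_smul K c, smul_inv_smul₀ hc']
    refine ⟨(algebraMap R K c)⁻¹ • b • y, mem_maximalModel.mpr ⟨z, hz, ?_⟩, hcy⟩
    -- After multiplication by `c`, both sides become the image of `b` times the Frobenius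
    -- difference.
    refine smul_right_injective _ hc ?_
    change c • coeffMap R A L z = c • toProduct K L ξ _
    rw [← map_smul, hzθ, ← map_smul, hcy, map_smul, map_smul, hy, map_sub, map_sub, map_pow,
      map_pow, toProduct_tensorPsi, ← hηx, shift_coeffMap]

/-- Its elements have finitely many coefficients, all integral over `R`, so they are integral
elements of an étale algebra. -/
theorem finite_maximalModel [PerfectField K] [FaithfulSMul A L] :
    Module.Finite R (maximalModel K L ξ) := by
  have := finite_orbitAlgebra hξ
  have : IsReduced (K ⊗[R] orbitAlgebra ξ) := isReduced_tensor_orbitAlgebra (L := L)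
  have := etale_of_finite_of_isReduced K (K ⊗[R] orbitAlgebra ξ)
  refine finite_of_forall_isIntegral R K _ fun x hx => ?_
  obtain ⟨η, hη, hηx⟩ := mem_maximalModel.mp hx
  rw [← isIntegral_algHom_iff (toProduct K L ξ) (toProduct_injective ξ), ← hηx]
  exact (isIntegral_of_finite_range (Algebra.mem_inf.mp hη).2
    fun _ => Algebra.IsIntegral.isIntegral _).map _

theorem isIntegralModel_maximalModel [PerfectField K] [FaithfulSMul A L] :
    IsIntegralModel K (tensorPsi K ξ) (maximalModel K L ξ) where
  isSubLambdaRing := isSubLambdaRing_maximalModel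
  finite := finite_maximalModel hξ
  bijective := by
    refine bijective_productMap_val R K _ fun x => ?_
    obtain ⟨c, hc, b, hb⟩ := exists_smul_eq_one_tmul R K x
    -- The model contains `R⟨ξ⟩`, which already spans `X` over `K`.
    refine ⟨c, hc, mem_maximalModel.mpr ⟨b, orbitAlgebra_le_finiteW hξ b.2, ?_⟩⟩
    rw [hb, toProduct_one_tmul]

omit hξ in
theorem le_maximalModel [IsIntegralClosure A R L] [FaithfulSMul A L]
    {B : Subalgebra R (K ⊗[R] orbitAlgebra ξ)} (hB : IsIntegralModel K (tensorPsi K ξ) B) :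
    B ≤ maximalModel K L ξ := by
  have hint (x) (hx : x ∈ B) : IsIntegral R x := by
    have := hB.finite
    exact (Algebra.IsIntegral.isIntegral (R := R) (⟨x, hx⟩ : B)).map B.val
  have hex (x) (hx : x ∈ B) : ∃ η, coeffMap R A L η = toProduct K L ξ x := by
    have this (a : NonzeroIdeal R) : ∃ v : A, algebraMap A L v = toProduct K L ξ x a :=
      IsIntegralClosure.isIntegral_iff.mp
        ((hint x hx).map ((Pi.evalAlgHom R (fun _ => L) a).comp (toProduct K L ξ)))
    choose η hη using this
    exact ⟨η, funext hη⟩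
  -- `N` is `B` viewed inside `A^{I_K}`, which is possible because coefficients of integral elements
  -- lie in the integral closure `A`. Its Frobenius differences lie in `p N`, so `N ≤ U_n` implies
  -- `N ≤ U_{n+1}`.
  set N : Subalgebra R (NonzeroIdeal R → A) := (B.map (toProduct K L ξ)).comap (coeffMap R A L)
  have hsmul (I : Ideal R) (x) (hx : x ∈ I • Subalgebra.toSubmodule B) :
      ∃ θ ∈ I • Subalgebra.toSubmodule N, coeffMap R A L θ = toProduct K L ξ x := by
    refine Submodule.smul_induction_on hx (fun r hr y hy => ?_) ?_
    · obtain ⟨η, hη⟩ := hex y hy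
      exact ⟨r • η, Submodule.smul_mem_smul hr ⟨y, hy, hη.symm⟩, by
        rw [map_smul, map_smul, hη]⟩
    · rintro y z ⟨η, hη, hηy⟩ ⟨θ, hθ, hθz⟩
      exact ⟨η + θ, add_mem hη hθ, by rw [map_add, map_add, hηy, hθz]⟩
  have hU (n : ℕ) : N ≤ U R A n := by
    induction n with
    | zero => exact le_top
    | succ n ih =>
      intro η hη
      refine ⟨ih hη, fun p => ?_⟩
      obtain ⟨x, hx, hxη⟩ := hη
      obtain ⟨θ, hθ, hθx⟩ := hsmul _ _ (hB.isSubLambdaRing.sub_pow_mem p hx)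
      have : θ = shift A (primeIdeal p) η - η ^ residueCard p := by
        refine coeffMap_injective (R := R) (L := L) ?_
        rw [hθx, map_sub, map_sub, map_pow, map_pow, toProduct_tensorPsi, ← shift_coeffMap]
        exact congrArg (fun t => shift L (primeIdeal p) t - t ^ residueCard p) hxη
      rw [← this]
      exact Submodule.smul_mono le_rfl (show Subalgebra.toSubmodule N ≤ _ from ih) hθ
  intro x hx
  obtain ⟨η, hη⟩ := hex x hx
  have hηint : IsIntegral R η := by
    rw [← isIntegral_algHom_iff (coeffMap R A L) coeffMap_injective, hη]
    exact (hint x hx).map _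
  exact mem_maximalModel.mpr ⟨η, Algebra.mem_inf.mpr
    ⟨mem_W.mpr fun n => hU n ⟨x, hx, hη.symm⟩, finite_range_of_isIntegral hηint⟩, hη⟩

end Model

end LambdaWitt

end

theorem mainTheorem3 (K : Type*) [Field K] [NumberField K]
    (Kbar : Type*) [Field Kbar] [Algebra K Kbar] [IsSepClosure K Kbar]
    (ξ : LambdaWitt.W (𝓞 K) (𝓞 Kbar)) (hξ : IsIntegral (𝓞 K) ξ) :
    LambdaWitt.IsLambdaRing (𝓞 K) (K ⊗[𝓞 K] LambdaWitt.orbitAlgebra ξ)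
        (LambdaWitt.tensorPsi K ξ) ∧
      Module.Finite K (K ⊗[𝓞 K] LambdaWitt.orbitAlgebra ξ) ∧
      Algebra.Etale K (K ⊗[𝓞 K] LambdaWitt.orbitAlgebra ξ) ∧
      (∃ B : Subalgebra (𝓞 K) (K ⊗[𝓞 K] LambdaWitt.orbitAlgebra ξ),
        LambdaWitt.IsIntegralModel K (LambdaWitt.tensorPsi K ξ) B) ∧
      IsGreatest
        {B : Subalgebra (𝓞 K) (K ⊗[𝓞 K] LambdaWitt.orbitAlgebra ξ) |
          LambdaWitt.IsIntegralModel K (LambdaWitt.tensorPsi K ξ) B}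
        (LambdaWitt.maximalModel K Kbar ξ) := by
  have : Algebra.IsIntegral (𝓞 K) (𝓞 Kbar) :=
    ⟨fun x => (NumberField.RingOfIntegers.isIntegral x).tower_top⟩
  have : IsIntegralClosure (𝓞 Kbar) (𝓞 K) Kbar := IsIntegralClosure.tower_top (R := ℤ)
  have : FaithfulSMul (𝓞 K) (𝓞 Kbar) := (faithfulSMul_iff_algebraMap_injective _ _).mpr
    (NumberField.RingOfIntegers.algebraMap.injective K Kbar)
  have : Module.IsTorsionFree (𝓞 K) (𝓞 Kbar) := inferInstance
  have := LambdaWitt.finite_orbitAlgebra hξ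
  have := LambdaWitt.isReduced_tensor_orbitAlgebra (K := K) (L := Kbar) (ξ := ξ)
  have hmodel := LambdaWitt.isIntegralModel_maximalModel (K := K) (L := Kbar) hξ
  exact ⟨LambdaWitt.isLambdaRing_tensorPsi, inferInstance,
    LambdaWitt.etale_of_finite_of_isReduced K _, ⟨_, hmodel⟩, hmodel,
    fun B hB => LambdaWitt.le_maximalModel hB⟩
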